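/- Let $\le$ be the coordinatewise order on $\mathbb{C}$: for real $a,b,c,d$, $a+ib\le c+id$ if and only if $a\le c$ and $b\le d$. Let $\zeta$ be the Riemann zeta function and let $$Z=\{s\in\mathbb{C} : 0\le s,\ \zeta(s)=0\},$$ that is, the set of non-trivial zeros of $\zeta$ with non-negative imaginary part. Then the Riemann hypothesis (every non-trivial zero of $\zeta$ has real part $\frac12$) is true if and only if $Z$, with the order inherited from $(\mathbb{C},\le)$, is a totally ordered set. -/

import Mathlib

/-- The coordinatewise order on `ℂ`: `a + ib ≤ c + id` iff `a ≤ c` and `b ≤ d`.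
(This is not Mathlib's scoped `ComplexOrder`, which compares only numbers with equal
imaginary parts.) -/
def coordLE (z w : ℂ) : Prop :=
  z.re ≤ w.re ∧ z.im ≤ w.im

/-- The coordinatewise order is a partial order on `ℂ`. -/
theorem coordLE_isPartialOrder : IsPartialOrder ℂ coordLE where
  refl _ := ⟨le_rfl, le_rfl⟩
  trans _ _ _ h₁ h₂ := ⟨h₁.1.trans h₂.1, h₁.2.trans h₂.2⟩
  antisymm _ _ h₁ h₂ := Complex.ext (h₁.1.antisymm h₂.1) (h₁.2.antisymm h₂.2)

/-- The set `Z = {s ∈ ℂ : 0 ≤ s, ζ(s) = 0}`, where `0 ≤ s` refers to the coordinatewise order.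
These are the non-trivial zeros with non-negative imaginary part, since the trivial zeros have
negative real part. The pole `1` is not in this set: see `one_notMem_zetaZ`. -/
def zetaZ : Set ℂ :=
  {s | coordLE 0 s ∧ riemannZeta s = 0}

/-- The value which Mathlib assigns to `ζ` at its pole is nonzero, so the pole is not in `Z`. -/
theorem one_notMem_zetaZ : (1 : ℂ) ∉ zetaZ :=
  fun h => riemannZeta_one_ne_zero h.2

/-! Under RH all of Z lies on one vertical line, where `coordLE` compares imaginary parts.
Conversely, a zero s and its reflection 1 - conj s have the same height. If u is a strictly higher
zero, totality puts both real parts at height Im s below both at height Im u; as each pair is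
symmetric about 1/2, all equal 1/2. So a higher zero must always exist: `infinite_twoXi_zeros`. If ξ
had finitely many zeros, its growth (order below two) would make it P(s) exp(a + bs). By ξ(s) = ξ(1
- s), ξ² would then be a polynomial, but ξ grows factorially at even integers. -/

/-! ### Hadamard factorization for finitely many zeros. -/

section EntireFunctions

open Filter Topology Metric Polynomial

/-- An entire function with finitely many zeros is a polynomial times a nowhere vanishing entire
function. -/
theorem Differentiable.exists_eq_polynomial_mul (S : Finset ℂ) {f : ℂ → ℂ}
    (hf : Differentiable ℂ f) (hS : ∀ z, f z = 0 → z ∈ S) :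
    ∃ (P : ℂ[X]) (g : ℂ → ℂ), P ≠ 0 ∧ Differentiable ℂ g ∧ (∀ z, g z ≠ 0) ∧
      ∀ z, f z = P.eval z * g z := by
  classical
  induction S using Finset.induction_on generalizing f with
  | empty => exact ⟨1, f, one_ne_zero, hf, fun z hz => by simpa using hS z hz, by simp⟩
  | insert a S ha ih =>
    obtain ⟨p, hp⟩ := hf.analyticAt a
    have hp0 : p ≠ 0 := by
      rintro rfl
      have h0 : ∀ z, f z = 0 := by
        have := (AnalyticOnNhd.eq_of_eventuallyEq (f := f) (g := 0) (z₀ := a)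
          (fun z _ => hf.analyticAt z) (fun z _ => analyticAt_const) hp.eventually_eq_zero)
        intro z
        rw [this]; rfl
      exact Set.infinite_univ ((insert a S).finite_toSet.subset fun z _ => hS z (h0 z))
    -- Iterating the slope at `a` divides out the zero there, keeping the function entire.
    set g : ℂ → ℂ := (Function.swap dslope a)^[p.order] f with hg
    have hgd : ∀ n : ℕ, Differentiable ℂ ((Function.swap dslope a)^[n] f) := by
      intro n
      induction n with
      | zero => exact hf
      | succ n ihn =>
        rw [Function.iterate_succ_apply', ← differentiableOn_univ]
        exact (Complex.differentiableOn_dslope univ_mem).2 ihn.differentiableOn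
    have hfg : ∀ z, f z = (z - a) ^ p.order * g z := hp.eq_pow_order_mul_iterate_dslope
    have hga : g a ≠ 0 := hp.iterate_dslope_fslope_ne_zero hp0
    obtain ⟨P, k, hP, hk, hk0, h⟩ := ih (hgd p.order) (by
      intro z hz
      have hfz : f z = 0 := by rw [hfg, hg, hz, mul_zero]
      rcases Finset.mem_insert.1 (hS z hfz) with rfl | h
      · exact absurd hz hga
      · exact h)
    refine ⟨(X - C a) ^ p.order * P, k,
      mul_ne_zero (pow_ne_zero _ (X_sub_C_ne_zero a)) hP, hk, hk0, fun z => ?_⟩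
    rw [hfg, hg, h]
    simp [mul_assoc]

/-- A nowhere vanishing entire function is the exponential of an entire function. -/
theorem Differentiable.exists_eq_exp {g : ℂ → ℂ} (hg : Differentiable ℂ g) (h0 : ∀ z, g z ≠ 0) :
    ∃ h : ℂ → ℂ, Differentiable ℂ h ∧ ∀ z, g z = Complex.exp (h z) := by
  have hd : Differentiable ℂ (fun z => _root_.deriv g z / g z) := fun z =>
    (hg.deriv z).div (hg z) (h0 z)
  obtain ⟨L, hL⟩ := hd.isExactOn_univ
  have hL' : ∀ z, HasDerivAt L (_root_.deriv g z / g z) z := fun z => hL z (Set.mem_univ z)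
  have hc : ∀ z, HasDerivAt (fun z => g z * Complex.exp (-L z)) 0 z := by
    intro z
    convert! (hg z).hasDerivAt.mul (hL' z).neg.cexp using 1
    field_simp [h0 z]
    ring
  have hconst := is_const_of_deriv_eq_zero (fun z => (hc z).differentiableAt)
    (fun z => (hc z).deriv)
  refine ⟨fun z => L z + (Complex.log (g 0) - L 0), fun z => ?_, fun z => ?_⟩
  · exact ((hL' z).differentiableAt).add_const _
  · have := hconst z 0
    rw [Complex.exp_add, Complex.exp_sub, Complex.exp_log (h0 0)]
    rw [Complex.exp_neg, Complex.exp_neg] at this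
    field_simp [Complex.exp_ne_zero] at this ⊢
    linear_combination this

/-- An entire function which is `o(‖z‖ ^ 2)` at infinity is affine. -/
theorem Differentiable.exists_eq_affine {h : ℂ → ℂ} (hh : Differentiable ℂ h)
    (hb : ∀ ε > 0, ∃ R : ℝ, ∀ z, R ≤ ‖z‖ → ‖h z‖ ≤ ε * ‖z‖ ^ 2) :
    ∃ a b : ℂ, ∀ z, h z = a + b * z := by
  have h2 : ∀ c, _root_.deriv (_root_.deriv h) c = 0 := by
    intro c
    rw [← norm_le_zero_iff]
    refine le_of_forall_pos_le_add fun δ hδ => ?_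
    -- Cauchy's estimate on a circle of radius r gives 2! · (δ / 8)(2r)² / r² = δ.
    obtain ⟨R, hR⟩ := hb (δ / 8) (by positivity)
    set r := max 1 (max ‖c‖ (R + ‖c‖)) with hr
    have hr1 : 1 ≤ r := le_max_left _ _
    have hrc : ‖c‖ ≤ r := (le_max_left _ _).trans (le_max_right _ _)
    have hrR : R + ‖c‖ ≤ r := (le_max_right _ _).trans (le_max_right _ _)
    have := Complex.norm_iteratedDeriv_le_of_forall_mem_sphere_norm_le (f := h) (c := c) (R := r)
      (C := δ / 8 * (2 * r) ^ 2) 2 (by linarith) hh.diffContOnCl (by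
        intro z hz
        have hz : ‖z - c‖ = r := by simpa [dist_eq_norm] using hz
        have h1 : r ≤ ‖z‖ + ‖c‖ := hz ▸ norm_sub_le z c
        have h3 : ‖z‖ ≤ 2 * r := by
          have := norm_add_le (z - c) c
          rw [sub_add_cancel] at this
          linarith
        refine (hR z (by linarith)).trans ?_
        gcongr)
    rw [iteratedDeriv_succ, iteratedDeriv_one] at this
    refine this.trans (le_of_eq ?_)
    have : r ≠ 0 := by linarith
    simp [Nat.factorial]
    field_simp
    ring
  have h1 := is_const_of_deriv_eq_zero hh.deriv h2
  have hc : ∀ z, HasDerivAt (fun z => h z - _root_.deriv h 0 * z) 0 z := by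
    intro z
    convert! (hh z).hasDerivAt.sub ((hasDerivAt_id z).const_mul (_root_.deriv h 0)) using 1
    rw [h1 z 0]; simp
  refine ⟨h 0, _root_.deriv h 0, fun z => ?_⟩
  have := is_const_of_deriv_eq_zero (fun z => (hc z).differentiableAt) (fun z => (hc z).deriv) z 0
  simp only [mul_zero, sub_zero] at this
  linear_combination this

/-- If the real part of an entire function is at most `o(‖z‖ ^ 2)`, then the function is affine. -/
theorem Differentiable.exists_eq_affine_of_re_le {h : ℂ → ℂ} (hh : Differentiable ℂ h)
    (hb : ∀ ε > 0, ∃ R : ℝ, ∀ z, R ≤ ‖z‖ → (h z).re ≤ ε * ‖z‖ ^ 2) :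
    ∃ a b : ℂ, ∀ z, h z = a + b * z := by
  refine hh.exists_eq_affine fun ε hε => ?_
  -- Borel–Carathéodory on the ball of radius 2‖z‖ yields (ε / 2)‖z‖² + 3‖h 0‖, at most (11ε /
  -- 16)‖z‖².
  obtain ⟨R, hR⟩ := hb (ε / 16) (by positivity)
  obtain ⟨M, hM⟩ := (isCompact_closedBall (0 : ℂ) R).exists_bound_of_continuousOn
    hh.continuous.continuousOn
  have hlim : Tendsto (fun r : ℝ => ε / 16 * r ^ 2) atTop atTop :=
    (tendsto_pow_atTop two_ne_zero).const_mul_atTop (by positivity)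
  obtain ⟨R₁, hR₁⟩ := eventually_atTop.1 (hlim.eventually_ge_atTop (max M (‖h 0‖ : ℝ)))
  refine ⟨max 1 R₁, fun z hz => ?_⟩
  have hz1 : 1 ≤ ‖z‖ := (le_max_left _ _).trans hz
  have hzR := hR₁ ‖z‖ ((le_max_right _ _).trans hz)
  have hMz : M ≤ ε / 16 * ‖z‖ ^ 2 := (le_max_left _ _).trans hzR
  have h0z : ‖h 0‖ ≤ ε / 16 * ‖z‖ ^ 2 := (le_max_right _ _).trans hzR
  have hmaps : Set.MapsTo h (ball 0 (2 * ‖z‖)) {w | w.re ≤ ε / 16 * (2 * ‖z‖) ^ 2} := by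
    intro w hw
    have hw : ‖w‖ < 2 * ‖z‖ := by simpa using hw
    show (h w).re ≤ _
    rcases le_total R ‖w‖ with hRw | hRw
    · refine (hR w hRw).trans ?_
      gcongr
    · refine (Complex.re_le_norm _).trans ((hM w (by simpa using hRw)).trans (hMz.trans ?_))
      gcongr
      linarith
  have hz0 : 0 < ‖z‖ := by linarith
  have := Complex.borelCaratheodory (z := z) (M := ε / 16 * (2 * ‖z‖) ^ 2) (by positivity)
    hh.differentiableOn hmaps (by positivity)
    (by rw [mem_ball_zero_iff]; linarith)
  refine this.trans ?_
  have e : 2 * ‖z‖ - ‖z‖ = ‖z‖ := by ring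
  rw [e]
  have e1 : 2 * (ε / 16 * (2 * ‖z‖) ^ 2) * ‖z‖ / ‖z‖ = ε / 2 * ‖z‖ ^ 2 := by field_simp; ring
  have e2 : ‖h 0‖ * (2 * ‖z‖ + ‖z‖) / ‖z‖ = 3 * ‖h 0‖ := by field_simp; ring
  rw [e1, e2]
  nlinarith [sq_nonneg ‖z‖]

/-- A nonzero polynomial is bounded away from zero near infinity. -/
theorem Polynomial.exists_pos_le_norm_eval {P : ℂ[X]} (hP : P ≠ 0) :
    ∃ c > 0, ∃ R : ℝ, ∀ z : ℂ, R ≤ ‖z‖ → c ≤ ‖P.eval z‖ := by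
  rcases lt_or_ge 0 P.degree with hd | hd
  · have h := P.tendsto_norm_atTop hd (tendsto_norm_cobounded_atTop (E := ℂ))
    have h1 := h.eventually_ge_atTop 1
    rw [← comap_norm_atTop, eventually_comap, eventually_atTop] at h1
    obtain ⟨R, hR⟩ := h1
    exact ⟨1, one_pos, R, fun z hz => hR _ hz z rfl⟩
  · rw [eq_C_of_degree_le_zero hd] at hP ⊢
    exact ⟨‖P.coeff 0‖, norm_pos_iff.2 (by simpa using hP), 0, fun z _ => by simp⟩

/-- An entire function of growth `exp (o(‖z‖ ^ 2))` with finitely many zeros is a polynomial times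
the exponential of an affine function. -/
theorem Differentiable.exists_eq_polynomial_mul_exp {f : ℂ → ℂ} (hf : Differentiable ℂ f)
    (hfin : {z | f z = 0}.Finite)
    (hb : ∀ ε > 0, ∃ R : ℝ, ∀ z, R ≤ ‖z‖ → ‖f z‖ ≤ Real.exp (ε * ‖z‖ ^ 2)) :
    ∃ (P : ℂ[X]) (a b : ℂ), ∀ z, f z = P.eval z * Complex.exp (a + b * z) := by
  obtain ⟨P, g, hP, hg, hg0, hfg⟩ := hf.exists_eq_polynomial_mul hfin.toFinset (by simp)
  obtain ⟨h, hh, hgh⟩ := hg.exists_eq_exp hg0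
  obtain ⟨c, hc, R₀, hR₀⟩ := Polynomial.exists_pos_le_norm_eval hP
  obtain ⟨a, b, hab⟩ := hh.exists_eq_affine_of_re_le (by
    intro ε hε
    obtain ⟨R, hR⟩ := hb (ε / 2) (by positivity)
    have hlim : Tendsto (fun r : ℝ => ε / 2 * r ^ 2) atTop atTop :=
      (tendsto_pow_atTop two_ne_zero).const_mul_atTop (by positivity)
    obtain ⟨R₁, hR₁⟩ := eventually_atTop.1 (hlim.eventually_ge_atTop (-Real.log c))
    refine ⟨max R₀ (max R R₁), fun z hz => ?_⟩
    have h1 := hR₀ z ((le_max_left _ _).trans hz)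
    have h2 := hR z (((le_max_left _ _).trans (le_max_right _ _)).trans hz)
    have h3 := hR₁ ‖z‖ (((le_max_right _ _).trans (le_max_right _ _)).trans hz)
    rw [hfg, hgh, norm_mul, Complex.norm_exp] at h2
    have h4 : Real.exp (Real.log c + (h z).re) ≤ Real.exp (ε / 2 * ‖z‖ ^ 2) := by
      rw [Real.exp_add, Real.exp_log hc]
      exact (mul_le_mul_of_nonneg_right h1 (Real.exp_pos _).le).trans h2
    have := Real.exp_le_exp.1 h4
    linarith)
  exact ⟨P, a, b, fun z => by rw [hfg, hgh, hab]⟩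

end EntireFunctions

/-! ### Growth of ξ and infinitude of its zeros. -/

section CompletedZeta

open Filter Topology

/-- `Λ₀` is an everywhere convergent Mellin transform, and x^(Re s - 1) ≤ x^(a - 1) + x^(b - 1) on
the strip. -/
theorem WeakFEPair.exists_norm_Λ₀_le {E : Type*} [NormedAddCommGroup E] [NormedSpace ℂ E]
    (P : WeakFEPair E) (a b : ℝ) :
    ∃ C, ∀ s : ℂ, a ≤ s.re → s.re ≤ b → ‖P.Λ₀ s‖ ≤ C := by
  have hconv : ∀ s, MellinConvergent P.f_modif s := fun s =>
    (P.isStrongFEPair_toStrongFEPair.hasMellin s).1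
  refine ⟨_, fun s ha hb => MeasureTheory.norm_integral_le_of_norm_le
    ((hconv a).norm.add (hconv b).norm) ?_⟩
  refine (MeasureTheory.ae_restrict_iff' measurableSet_Ioi).2 (.of_forall fun x hx => ?_)
  have hx : 0 < x := hx
  simp only [norm_smul, Complex.norm_cpow_eq_rpow_re_of_pos hx, Complex.sub_re, Complex.one_re,
    Complex.ofReal_re, Pi.add_apply]
  rw [← add_mul]
  refine mul_le_mul_of_nonneg_right ?_ (norm_nonneg _)
  rcases le_total 1 x with h1 | h1
  · have := Real.rpow_le_rpow_of_exponent_le h1 (sub_le_sub_right hb 1)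
    have := Real.rpow_nonneg hx.le (a - 1)
    linarith
  · have := Real.rpow_le_rpow_of_exponent_ge hx h1 (sub_le_sub_right ha 1)
    have := Real.rpow_nonneg hx.le (b - 1)
    linarith

theorem exists_norm_completedRiemannZeta₀_le (a b : ℝ) :
    ∃ C, ∀ s : ℂ, a ≤ s.re → s.re ≤ b → ‖completedRiemannZeta₀ s‖ ≤ C := by
  obtain ⟨C, hC⟩ := (HurwitzZeta.hurwitzEvenFEPair 0).exists_norm_Λ₀_le (a / 2) (b / 2)
  refine ⟨C / 2, fun s ha hb => ?_⟩
  have : (s / 2).re = s.re / 2 := by simp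
  have := hC (s / 2) (by linarith) (by linarith)
  rw [completedRiemannZeta₀, HurwitzZeta.completedHurwitzZetaEven₀, norm_div]
  simpa using div_le_div_of_nonneg_right this two_pos.le

theorem Complex.norm_Gamma_le {s : ℂ} (hs : 0 < s.re) : ‖Complex.Gamma s‖ ≤ Real.Gamma s.re := by
  rw [Complex.Gamma_eq_integral hs, Real.Gamma_eq_integral hs, Complex.GammaIntegral]
  refine MeasureTheory.norm_integral_le_of_norm_le (Real.GammaIntegral_convergent hs) ?_
  refine (MeasureTheory.ae_restrict_iff' measurableSet_Ioi).2 (.of_forall fun x hx => ?_)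
  have hx : 0 < x := hx
  rw [norm_mul, Complex.norm_cpow_eq_rpow_re_of_pos hx, Complex.norm_real,
    Real.norm_of_nonneg (Real.exp_pos _).le]
  simp

theorem Real.Gamma_le_factorial {x : ℝ} {n : ℕ} (hx : 1 ≤ x) (hn : x ≤ n) :
    Real.Gamma x ≤ n.factorial := by
  -- The shift by 1 reaches [2, ∞), where Γ is monotone; then Γ(x) ≤ xΓ(x) = Γ(x + 1).
  have h := Real.Gamma_strictMonoOn_Ici.monotoneOn (a := x + 1) (b := n + 1)
    (by simp only [Set.mem_Ici]; linarith) (by simp only [Set.mem_Ici]; linarith) (by linarith)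
  rw [Real.Gamma_nat_eq_factorial, Real.Gamma_add_one (by linarith)] at h
  nlinarith [Real.Gamma_pos_of_pos (by linarith : 0 < x)]

theorem norm_completedRiemannZeta_le {s : ℂ} (hs : 2 ≤ s.re) {n : ℕ} (hn : s.re / 2 ≤ n) :
    ‖completedRiemannZeta s‖ ≤ n.factorial * ∑' k : ℕ, 1 / (k : ℝ) ^ 2 := by
  have hre : (s / 2).re = s.re / 2 := by simp
  have hsum : Summable fun k : ℕ => 1 / (k : ℝ) ^ 2 := Real.summable_one_div_nat_pow.2 one_lt_two
  rw [completedZeta_eq_tsum_of_one_lt_re (by linarith), norm_mul, norm_mul]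
  have h1 : ‖(Real.pi : ℂ) ^ (-s / 2)‖ ≤ 1 := by
    rw [Complex.norm_cpow_eq_rpow_re_of_pos Real.pi_pos]
    refine Real.rpow_le_one_of_one_le_of_nonpos (by linarith [Real.pi_gt_three]) ?_
    simp only [Complex.div_ofNat_re, Complex.neg_re]
    linarith
  have h2 : ‖Complex.Gamma (s / 2)‖ ≤ n.factorial :=
    (Complex.norm_Gamma_le (by linarith)).trans
      (Real.Gamma_le_factorial (by linarith) (by linarith))
  have h3 : ‖∑' k : ℕ, 1 / (k : ℂ) ^ s‖ ≤ ∑' k : ℕ, 1 / (k : ℝ) ^ 2 := by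
    refine tsum_of_norm_bounded hsum.hasSum fun k => ?_
    rcases Nat.eq_zero_or_pos k with rfl | hk
    -- For s ≠ 0 the term k = 0 is 1 / 0 = 0 on both sides.
    · have : s ≠ 0 := by rintro rfl; simp at hs; linarith
      simp [this]
    · rw [norm_div, norm_one, Complex.norm_natCast_cpow_of_pos hk, ← Real.rpow_natCast]
      have : (1 : ℝ) ≤ k := by exact_mod_cast hk
      gcongr
      simpa using hs
  have h0 : 0 ≤ ∑' k : ℕ, 1 / (k : ℝ) ^ 2 := tsum_nonneg fun k => by positivity
  calc _ ≤ 1 * (n.factorial : ℝ) * ∑' k : ℕ, 1 / (k : ℝ) ^ 2 := by gcongr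
    _ = _ := by ring

/-- Twice the Riemann xi function, an entire function equal to `s (s - 1) Λ(s)` away from the poles
of `Λ`. -/
noncomputable def twoXi (s : ℂ) : ℂ :=
  s * (s - 1) * completedRiemannZeta₀ s + 1

theorem differentiable_twoXi : Differentiable ℂ twoXi :=
  ((differentiable_id.mul (differentiable_id.sub_const 1)).mul
    differentiable_completedZeta₀).add_const 1

theorem twoXi_one_sub (s : ℂ) : twoXi (1 - s) = twoXi s := by
  rw [twoXi, twoXi, completedRiemannZeta₀_one_sub]
  ring

theorem twoXi_eq {s : ℂ} (h0 : s ≠ 0) (h1 : s ≠ 1) :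
    twoXi s = s * (s - 1) * completedRiemannZeta s := by
  have : 1 - s ≠ 0 := sub_ne_zero.2 h1.symm
  rw [completedRiemannZeta_eq, twoXi]
  field_simp
  ring

/-- For Re s ≤ 2 the entire part `completedRiemannZeta₀` is bounded; beyond, the Dirichlet series
and Γ give a factorial bound. -/
theorem exists_norm_twoXi_le_of_half_le_re :
    ∃ K > 0, ∀ s : ℂ, 1 / 2 ≤ s.re →
      ‖twoXi s‖ ≤ K * (‖s‖ + 2) ^ 2 * Real.exp ((‖s‖ + 2) * Real.log (‖s‖ + 2)) := by
  obtain ⟨C, hC⟩ := exists_norm_completedRiemannZeta₀_le (1 / 2) 2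
  set Z := ∑' k : ℕ, 1 / (k : ℝ) ^ 2 with hZ
  have h0 : 0 ≤ Z := tsum_nonneg fun k => by positivity
  refine ⟨|C| + Z + 1, by positivity, fun s hs => ?_⟩
  set r := ‖s‖ with hr
  have hr0 : 0 ≤ r := norm_nonneg s
  have hs1 : ‖s * (s - 1)‖ ≤ (r + 2) ^ 2 := by
    have := norm_sub_le s 1
    rw [norm_one] at this
    rw [norm_mul]
    nlinarith
  have hlog : 0 ≤ Real.log (r + 2) := Real.log_nonneg (by linarith)
  have hexp : 1 ≤ Real.exp ((r + 2) * Real.log (r + 2)) := Real.one_le_exp (by positivity)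
  rcases le_total s.re 2 with h2 | h2
  · have hn : ‖twoXi s‖ ≤ (r + 2) ^ 2 * |C| + 1 := by
      rw [twoXi]
      refine (norm_add_le _ _).trans ?_
      rw [norm_mul _ (completedRiemannZeta₀ s), norm_one]
      have := (hC s hs h2).trans (le_abs_self C)
      gcongr
    calc _ ≤ (r + 2) ^ 2 * |C| + 1 := hn
      _ ≤ (|C| + Z + 1) * (r + 2) ^ 2 := by nlinarith [mul_nonneg h0 (sq_nonneg (r + 2))]
      _ = (|C| + Z + 1) * (r + 2) ^ 2 * 1 := (mul_one _).symm
      _ ≤ _ := by gcongr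
  · have hsr : s.re ≤ r := Complex.re_le_norm s
    set n := ⌈r⌉₊ with hn
    have hn1 : r ≤ n := Nat.le_ceil r
    have hn2 : (n : ℝ) ≤ r + 2 := by linarith [Nat.ceil_lt_add_one hr0]
    have hn0 : 0 < (n : ℝ) := by linarith
    have hfac : (n.factorial : ℝ) ≤ Real.exp ((r + 2) * Real.log (r + 2)) := by
      calc (n.factorial : ℝ) ≤ (n : ℝ) ^ n := by exact_mod_cast Nat.factorial_le_pow n
        _ = Real.exp (n * Real.log n) := by
          rw [mul_comm, ← Real.rpow_def_of_pos hn0, Real.rpow_natCast]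
        _ ≤ _ := by
          gcongr
    have hΛ := norm_completedRiemannZeta_le h2 (n := n) (by linarith)
    have hs0 : s ≠ 0 := by rintro rfl; simp at h2; linarith
    have hs1' : s ≠ 1 := by rintro rfl; simp at h2
    rw [twoXi_eq hs0 hs1', norm_mul _ (completedRiemannZeta s)]
    calc _ ≤ (r + 2) ^ 2 * (Real.exp ((r + 2) * Real.log (r + 2)) * Z) := by
          gcongr
          exact hΛ.trans (by gcongr)
      _ = Z * (r + 2) ^ 2 * Real.exp ((r + 2) * Real.log (r + 2)) := by ring
      _ ≤ _ := by gcongr; linarith [abs_nonneg C]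

theorem exists_norm_twoXi_le :
    ∃ K > 0, ∀ s : ℂ,
      ‖twoXi s‖ ≤ K * (‖s‖ + 3) ^ 2 * Real.exp ((‖s‖ + 3) * Real.log (‖s‖ + 3)) := by
  obtain ⟨K, hK, h⟩ := exists_norm_twoXi_le_of_half_le_re
  have hmono : ∀ x y : ℝ, 0 ≤ x → x ≤ y + 1 →
      K * (x + 2) ^ 2 * Real.exp ((x + 2) * Real.log (x + 2)) ≤
        K * (y + 3) ^ 2 * Real.exp ((y + 3) * Real.log (y + 3)) := by
    intro x y hx hxy
    have hlog : 0 ≤ Real.log (x + 2) := Real.log_nonneg (by linarith)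
    have hxy' : x + 2 ≤ y + 3 := by linarith
    have hy : 0 ≤ y + 3 := by linarith
    gcongr
  refine ⟨K, hK, fun s => ?_⟩
  rcases le_total (1 / 2) s.re with hs | hs
  · exact (h s hs).trans (hmono _ _ (norm_nonneg _) (by linarith))
  · rw [← twoXi_one_sub]
    refine (h (1 - s) (by simp; linarith)).trans (hmono _ _ (norm_nonneg _) ?_)
    have := norm_sub_le 1 s
    rw [norm_one] at this
    linarith

/-- The function `ξ` has order less than two. -/
theorem norm_twoXi_le_exp {ε : ℝ} (hε : 0 < ε) :
    ∃ R : ℝ, ∀ s : ℂ, R ≤ ‖s‖ → ‖twoXi s‖ ≤ Real.exp (ε * ‖s‖ ^ 2) := by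
  obtain ⟨K, hK, h⟩ := exists_norm_twoXi_le
  have hlog := (Real.isLittleO_log_id_atTop.comp_tendsto
    (tendsto_atTop_add_const_right atTop (3 : ℝ) tendsto_id)).bound
      (show 0 < ε / 32 by positivity)
  have hlim : Tendsto (fun r : ℝ => ε / 2 * r ^ 2) atTop atTop :=
    (tendsto_pow_atTop two_ne_zero).const_mul_atTop (by positivity)
  -- From r ≥ 5 follow r + 3 ≤ 2r and r + 5 ≤ 2r.
  obtain ⟨R, hR⟩ := eventually_atTop.1 (hlog.and ((hlim.eventually_ge_atTop (Real.log K)).and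
    (eventually_ge_atTop 5)))
  refine ⟨R, fun s hs => ?_⟩
  obtain ⟨h1, h2, h3⟩ := hR ‖s‖ hs
  set r := ‖s‖
  have hr3 : 0 < r + 3 := by linarith
  have h1 : Real.log (r + 3) ≤ ε / 32 * (r + 3) := by
    simp only [Function.comp_apply, id_eq, Real.norm_eq_abs, abs_of_pos hr3] at h1
    exact (le_abs_self _).trans h1
  refine (h s).trans ?_
  have e : K * (r + 3) ^ 2 * Real.exp ((r + 3) * Real.log (r + 3)) =
      Real.exp (Real.log K + (r + 5) * Real.log (r + 3)) := by
    rw [show Real.log K + (r + 5) * Real.log (r + 3) =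
      Real.log K + (Real.log (r + 3) + Real.log (r + 3)) + (r + 3) * Real.log (r + 3) by ring,
      Real.exp_add, Real.exp_add, Real.exp_add, Real.exp_log hK, Real.exp_log hr3]
    ring
  rw [e, Real.exp_le_exp]
  have h4 : (r + 5) * Real.log (r + 3) ≤ (2 * r) * (ε / 32 * (2 * r)) := by
    refine mul_le_mul (by linarith) (h1.trans ?_) (Real.log_nonneg (by linarith)) (by linarith)
    gcongr
    linarith
  nlinarith [mul_pos hε (pow_pos (by linarith : 0 < r) 2)]

theorem factorial_div_pow_pi_le_norm_twoXi (n : ℕ) :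
    n.factorial / Real.pi ^ (n + 1) ≤ ‖twoXi (2 * (n + 1))‖ := by
  have hn : (0 : ℝ) ≤ n := n.cast_nonneg
  have hs : 1 < (2 * (n + 1) : ℂ).re := by simp; linarith
  have h0 : (2 * (n + 1) : ℂ) ≠ 0 := by intro h; rw [h] at hs; simp at hs; linarith
  have h1 : (2 * (n + 1) : ℂ) ≠ 1 := by intro h; rw [h] at hs; simp at hs
  have hprod : 1 ≤ ‖(2 * (n + 1) : ℂ) * (2 * (n + 1) - 1)‖ := by
    refine le_trans ?_ (Complex.re_le_norm _)
    simp
    nlinarith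
  have hpi : ‖(Real.pi : ℂ) ^ (-(2 * (n + 1) : ℂ) / 2)‖ = (Real.pi ^ (n + 1))⁻¹ := by
    rw [Complex.norm_cpow_eq_rpow_re_of_pos Real.pi_pos, ← Real.rpow_natCast,
      ← Real.rpow_neg Real.pi_pos.le]
    congr 1
    simp
    ring
  have hGamma : ‖Complex.Gamma ((2 * (n + 1) : ℂ) / 2)‖ = n.factorial := by
    rw [mul_div_cancel_left₀ _ two_ne_zero, Complex.Gamma_nat_eq_factorial, Complex.norm_natCast]
  have hsum : Summable fun k : ℕ => 1 / (k : ℝ) ^ (2 * (n + 1)) :=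
    Real.summable_one_div_nat_pow.2 (by omega)
  have hzeta : 1 ≤ ‖∑' k : ℕ, 1 / (k : ℂ) ^ (2 * (n + 1) : ℂ)‖ := by
    have e : ∑' k : ℕ, 1 / (k : ℂ) ^ (2 * (n + 1) : ℂ) =
        ((∑' k : ℕ, 1 / (k : ℝ) ^ (2 * (n + 1)) : ℝ) : ℂ) := by
      rw [Complex.ofReal_tsum]
      congr 1 with k
      rw [show (2 * (n + 1) : ℂ) = ((2 * (n + 1) : ℕ) : ℂ) by push_cast; ring,
        Complex.cpow_natCast]
      push_cast
      ring
    rw [e, Complex.norm_real]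
    refine le_trans ?_ (le_abs_self _)
    simpa using hsum.le_tsum 1 fun k _ => by positivity
  rw [twoXi_eq h0 h1, completedZeta_eq_tsum_of_one_lt_re hs, norm_mul (_ * _) (_ * _ * _),
    norm_mul (_ * _) (∑' _, _), norm_mul (_ ^ _) _, hpi, hGamma]
  calc (n.factorial : ℝ) / Real.pi ^ (n + 1)
      = 1 * ((Real.pi ^ (n + 1))⁻¹ * n.factorial * 1) := by ring
    _ ≤ _ := by gcongr

theorem Polynomial.eval_natCast_isLittleO_two_pow (Q : Polynomial ℂ) :
    (fun n : ℕ => Q.eval (n : ℂ)) =o[atTop] fun n => (2 : ℝ) ^ n := by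
  induction Q using Polynomial.induction_on' with
  | add p q hp hq => simpa using hp.add hq
  | monomial k a =>
    simp only [Polynomial.eval_monomial]
    exact (isLittleO_pow_const_const_pow_of_one_lt k (by norm_num)).const_mul_left a

/-- `ξ` has infinitely many zeros. -/
theorem infinite_twoXi_zeros : {s | twoXi s = 0}.Infinite := by
  intro hfin
  obtain ⟨P, a, b, h⟩ := differentiable_twoXi.exists_eq_polynomial_mul_exp hfin
    fun ε hε => norm_twoXi_le_exp hε
  set L : Polynomial ℂ := 2 * (Polynomial.X + 1) with hL
  set D := ‖Complex.exp (2 * a + b)‖ with hD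
  have hsq : ∀ n : ℕ, ‖twoXi (2 * (n + 1))‖ ^ 2 =
      ‖(P.comp L * P.comp (1 - L)).eval (n : ℂ)‖ * D := by
    intro n
    rw [sq]
    nth_rewrite 2 [← twoXi_one_sub]
    rw [← norm_mul, hD, ← norm_mul, h, h]
    congr 1
    simp only [hL, Polynomial.eval_mul, Polynomial.eval_comp, Polynomial.eval_sub,
      Polynomial.eval_add, Polynomial.eval_X, Polynomial.eval_one, Polynomial.eval_ofNat]
    rw [show 2 * a + b = (a + b * (2 * (n + 1))) + (a + b * (1 - 2 * (n + 1))) by ring,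
      Complex.exp_add (a + b * (2 * (n + 1)))]
    ring
  have hlittle := (P.comp L * P.comp (1 - L)).eval_natCast_isLittleO_two_pow.bound one_pos
  have hfac := FloorSemiring.tendsto_pow_div_factorial_atTop (2 * Real.pi ^ 2)
  have hD0 : 0 ≤ D := norm_nonneg _
  have hsmall := hfac.eventually_lt_const (show 0 < 1 / (D * Real.pi ^ 2 + 1) by positivity)
  -- For such n, n!² ≤ (2π²)ⁿDπ² < n!, which is absurd.
  obtain ⟨n, hn1, hn2⟩ := (hlittle.and hsmall).exists
  have hlow := factorial_div_pow_pi_le_norm_twoXi n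
  have hpos : (1 : ℝ) ≤ n.factorial := by exact_mod_cast n.factorial_pos
  have h1 : (n.factorial / Real.pi ^ (n + 1)) ^ 2 ≤ 2 ^ n * D := by
    calc _ ≤ ‖twoXi (2 * (n + 1))‖ ^ 2 := by gcongr
      _ = _ := hsq n
      _ ≤ _ := by
        gcongr
        simpa using hn1
  rw [div_lt_div_iff₀ (by positivity) (by positivity), one_mul] at hn2
  rw [div_pow, div_le_iff₀ (by positivity)] at h1
  have e : 2 ^ n * D * (Real.pi ^ (n + 1)) ^ 2 = (2 * Real.pi ^ 2) ^ n * (D * Real.pi ^ 2) := by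
    rw [mul_pow, ← pow_mul, ← pow_mul]
    ring
  rw [e] at h1
  have : 0 < (2 * Real.pi ^ 2) ^ n := by positivity
  nlinarith

end CompletedZeta

/-! ### Zeros of ξ versus zeros of ζ, and symmetries. -/

section ZetaZeros

open ComplexConjugate

theorem riemannZeta_eq_zero_of_twoXi_eq_zero {s : ℂ} (hs : twoXi s = 0) : riemannZeta s = 0 := by
  have h0 : s ≠ 0 := by rintro rfl; simp [twoXi] at hs
  have h1 : s ≠ 1 := by rintro rfl; simp [twoXi] at hs
  rw [twoXi_eq h0 h1] at hs
  have : completedRiemannZeta s = 0 :=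
    (mul_eq_zero.1 hs).resolve_left (mul_ne_zero h0 (sub_ne_zero.2 h1))
  rw [riemannZeta_def_of_ne_zero h0, this, zero_div]

theorem re_lt_one_of_twoXi_eq_zero {s : ℂ} (hs : twoXi s = 0) : s.re < 1 := by
  by_contra! h
  exact riemannZeta_ne_zero_of_one_le_re h (riemannZeta_eq_zero_of_twoXi_eq_zero hs)

theorem re_pos_of_twoXi_eq_zero {s : ℂ} (hs : twoXi s = 0) : 0 < s.re := by
  have := re_lt_one_of_twoXi_eq_zero (s := 1 - s) (by rwa [twoXi_one_sub])
  simp at this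
  linarith

/-- The non-trivial zeros of `ζ` are zeros of `ξ`. -/
theorem twoXi_eq_zero_of_riemannZeta_eq_zero {s : ℂ} (hs : riemannZeta s = 0)
    (htriv : ¬∃ n : ℕ, s = -2 * (n + 1)) (h1 : s ≠ 1) : twoXi s = 0 := by
  have h0 : s ≠ 0 := by rintro rfl; rw [riemannZeta_zero] at hs; norm_num at hs
  have hΓ : s.Gammaℝ ≠ 0 := by
    rw [Ne, Complex.Gammaℝ_eq_zero_iff]
    rintro ⟨n, rfl⟩
    cases n with
    | zero => simp at h0
    | succ n => exact htriv ⟨n, by push_cast; ring⟩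
  rw [riemannZeta_def_of_ne_zero h0, div_eq_zero_iff, or_iff_left hΓ] at hs
  rw [twoXi_eq h0 h1, hs, mul_zero]

theorem not_trivial_zero_of_re_nonneg {s : ℂ} (hs : 0 ≤ s.re) : ¬∃ n : ℕ, s = -2 * (n + 1) := by
  rintro ⟨n, rfl⟩
  have : (0 : ℝ) ≤ n := n.cast_nonneg
  simp at hs
  linarith

/-- Inherited from ζ: in the open strip there are no trivial zeros and no pole. -/
theorem twoXi_conj_eq_zero {s : ℂ} (hs : twoXi s = 0) : twoXi (conj s) = 0 := by
  refine twoXi_eq_zero_of_riemannZeta_eq_zero ?_ (not_trivial_zero_of_re_nonneg ?_) ?_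
  · rw [riemannZeta_conj, riemannZeta_eq_zero_of_twoXi_eq_zero hs, map_zero]
  · simpa using (re_pos_of_twoXi_eq_zero hs).le
  · intro h
    have h1 := congrArg Complex.re h
    rw [Complex.conj_re, Complex.one_re] at h1
    exact (re_lt_one_of_twoXi_eq_zero hs).ne h1

/-- Reflecting a zero of `ξ` in the critical line gives a zero. -/
theorem twoXi_one_sub_conj_eq_zero {s : ℂ} (hs : twoXi s = 0) : twoXi (1 - conj s) = 0 := by
  rw [twoXi_one_sub, twoXi_conj_eq_zero hs]

/-- `ξ` has zeros with arbitrarily large imaginary part. -/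
theorem exists_twoXi_eq_zero_lt_im (T : ℝ) : ∃ s, twoXi s = 0 ∧ T < s.im := by
  by_contra! h
  -- By conjugation, heights bounded above are bounded below; a compact rectangle holds finitely
  -- many zeros of ζ.
  refine infinite_twoXi_zeros ((((isCompact_Icc (a := (0 : ℝ)) (b := 1)).reProdIm
    (isCompact_Icc (a := -T) (b := T))).inter_riemannZetaZeros_finite).subset fun s hs => ⟨?_, ?_⟩)
  · have h1 := h _ (twoXi_conj_eq_zero hs)
    rw [Complex.conj_im] at h1
    exact Complex.mem_reProdIm.2 ⟨⟨(re_pos_of_twoXi_eq_zero hs).le,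
      (re_lt_one_of_twoXi_eq_zero hs).le⟩, by linarith, h s hs⟩
  · exact riemannZeta_eq_zero_of_twoXi_eq_zero hs

theorem mem_zetaZ_of_twoXi_eq_zero {s : ℂ} (hs : twoXi s = 0) (him : 0 ≤ s.im) : s ∈ zetaZ :=
  ⟨⟨(re_pos_of_twoXi_eq_zero hs).le, him⟩, riemannZeta_eq_zero_of_twoXi_eq_zero hs⟩

theorem re_eq_half_of_coordLE_total
    (htot : ∀ s ∈ zetaZ, ∀ t ∈ zetaZ, coordLE s t ∨ coordLE t s) {s : ℂ} (hs : twoXi s = 0)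
    (him : 0 ≤ s.im) : s.re = 1 / 2 := by
  obtain ⟨u, hu, hlt⟩ := exists_twoXi_eq_zero_lt_im s.im
  have key : ∀ z w : ℂ, twoXi z = 0 → twoXi w = 0 → z.im = s.im → w.im = u.im →
      z.re ≤ w.re := by
    intro z w hz hw hzi hwi
    rcases htot z (mem_zetaZ_of_twoXi_eq_zero hz (by linarith)) w
      (mem_zetaZ_of_twoXi_eq_zero hw (by linarith)) with h | h
    · exact h.1
    · have := h.2
      linarith
  have hs' := twoXi_one_sub_conj_eq_zero hs
  have hu' := twoXi_one_sub_conj_eq_zero hu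
  have h1 := key s u hs hu rfl rfl
  have h2 := key s _ hs hu' rfl (by simp)
  have h3 := key _ u hs' hu (by simp) rfl
  have h4 := key _ _ hs' hu' (by simp) (by simp)
  simp only [Complex.sub_re, Complex.one_re, Complex.conj_re] at h2 h3 h4
  -- With σ = Re s, τ = Re u: `h1` and `h4` give σ = τ, `h2` and `h3` give σ + τ = 1.
  linarith

end ZetaZeros

theorem lemma3p1 :
    RiemannHypothesis ↔ IsLinearOrder zetaZ (fun s t : zetaZ => coordLE (s : ℂ) (t : ℂ)) := by
  constructor
  · intro hRH
    have hre : ∀ s : zetaZ, (s : ℂ).re = 1 / 2 := fun s =>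
      hRH s s.2.2 (not_trivial_zero_of_re_nonneg s.2.1.1)
        fun h => one_notMem_zetaZ (h ▸ s.2)
    exact
      { refl := fun s => coordLE_isPartialOrder.refl _
        trans := fun s t u => coordLE_isPartialOrder.trans _ _ _
        antisymm := fun s t h₁ h₂ => Subtype.ext (coordLE_isPartialOrder.antisymm _ _ h₁ h₂)
        total := fun s t => (le_total (s : ℂ).im (t : ℂ).im).imp
          (fun h => ⟨((hre s).trans (hre t).symm).le, h⟩)
          (fun h => ⟨((hre t).trans (hre s).symm).le, h⟩) }
  · intro hlin s hs htriv h1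
    have htot : ∀ s ∈ zetaZ, ∀ t ∈ zetaZ, coordLE s t ∨ coordLE t s := fun s hs t ht =>
      hlin.total ⟨s, hs⟩ ⟨t, ht⟩
    have hξ := twoXi_eq_zero_of_riemannZeta_eq_zero hs htriv h1
    rcases le_total 0 s.im with him | him
    · exact re_eq_half_of_coordLE_total htot hξ him
    · simpa using re_eq_half_of_coordLE_total htot (twoXi_conj_eq_zero hξ) (by simpa using him)
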